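/- Let $K$ be a long knot given by an oriented diagram in the oriented plane: a proper curve $\gamma:\mathbb R\to\mathbb R^2$ whose only self-intersections are $n$ transverse double points (crossings), numbered $1,\dots,n$, with one strand at each crossing designated as the over strand and the other as the under strand. The regions are the connected components of the complement of the curve; the bounded ones are numbered $1,\dots,n$. For a crossing $i$: - $\sigma_i=\pm1$ is its sign ($+1$ if the directions of the over and of the under strand, in this order, form a positively oriented basis of the plane); $d_i=+1$ if the curve passes over crossing $i$ before it passes under it, and $d_i=-1$ otherwise; $S(i)=\sigma_i d_i$; - the span $Sp(i)$ is the open segment of the curve between its two passages through crossing $i$; $T_{ij}=1$ if the curve passes under crossing $j$ while it traverses $Sp(i)$, and $T_{ij}=0$ otherwise; - the four corners at crossing $i$ are marked as follows: along the oriented over strand, the corners on its right are marked first $-x$, then $x$, and those on its left first $1$, then $-1$. Let $A(K)$ be the $n\times n$ matrix over $\mathbb Z[x,x^{-1}]$ whose $(i,l)$ entry is the sum of the markings of those corners at crossing $i$ that lie in the bounded region $l$. Let $W(K)$ be the $n\times n$ matrix whose $(l,j)$ entry is the winding number of any point of the bounded region $l$ with respect to the loop $Sp(j)$, where clockwise turns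 are counted positively (that is, a crossing of $Sp(j)$ from left to right over a ray going from the point to infinity counts $+1$, and one from right to left counts $-1$). Let $\Sigma(K)$, $S(K)$, $X^{-S}$ and $X^{-(1+S)/2}$ be the diagonal matrices with $i$-th entries $\sigma_i$, $S(i)$, $x^{-S(i)}$ and $x^{-(1+S(i))/2}$. Then $$\Sigma(K)\,A(K)\,W(K)\,S(K)\,X^{-(1+S)/2}=I+T^t\,(I-X^{-S}).$$ Moreover, $(A(K)W(K))_{jj}=d_j\,x^{(1+S(j))/2}$ for all $j$, and $(A(K)W(K))_{ij}=\sigma_i\,(x-1)\,T_{ji}$ for all $i\neq j$. -/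

import Mathlib

open scoped Topology LaurentPolynomial

noncomputable section

/-- An oriented diagram of a long knot, with `n` crossings numbered by `Fin n`: a continuous proper
curve in the oriented plane `ℂ` (traversed by the ant in the direction of increasing time), whose
only self-intersections are `n` transverse double points. Crossing `i` is passed over at
time `overTime i` and under at time `underTime i`. Differentiability is only required at the crossings, so
that both smooth and polygonal diagrams are covered. -/
structure LongKnotDiagram (n : ℕ) where
  curve : ℝ → ℂ
  continuous_curve : Continuous curve
  proper_curve : Filter.Tendsto curve (Filter.cocompact ℝ) (Filter.cocompact ℂ)
  overTime : Fin n → ℝ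
  underTime : Fin n → ℝ
  over_ne_under : ∀ i, overTime i ≠ underTime i
  curve_over_eq_under : ∀ i, curve (overTime i) = curve (underTime i)
  /-- every self-intersection is one of the numbered crossings -/
  exists_crossing : ∀ s t, s ≠ t → curve s = curve t →
    ∃ i, (s = overTime i ∧ t = underTime i) ∨ (s = underTime i ∧ t = overTime i)
  /-- different crossings are different points of the plane (so there are no triple points) -/
  crossing_injective : Function.Injective fun i => curve (overTime i)
  differentiableAt_over : ∀ i, DifferentiableAt ℝ curve (overTime i)
  differentiableAt_under : ∀ i, DifferentiableAt ℝ curve (underTime i)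
  transverse : ∀ i, (starRingEnd ℂ (deriv curve (overTime i)) * deriv curve (underTime i)).im ≠ 0

/-- `k` is the winding number around `z` of the closed curve `γ` restricted to `[a, b]`, counted
positively in the clockwise direction: if `θ` is a continuous determination of the argument
of `γ - z`, then `θ a - θ b = 2 π k`. (Equivalently, along a generic ray from `z` to infinity,
a crossing of the curve from left to right counts `+1`, and one from right to left `-1`.) -/
def IsClockwiseWindingNumber (γ : ℝ → ℂ) (a b : ℝ) (z : ℂ) (k : ℤ) : Prop :=
  (∀ t ∈ Set.Icc a b, γ t ≠ z) ∧
  ∃ θ : ℝ → ℝ, ContinuousOn θ (Set.Icc a b) ∧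
    (∀ t ∈ Set.Icc a b, γ t - z = ‖γ t - z‖ * Complex.exp (θ t * Complex.I)) ∧
    θ a - θ b = 2 * Real.pi * k

namespace LongKnotDiagram

variable {n : ℕ} (D : LongKnotDiagram n)

/-- The point of the plane at which crossing `i` sits. -/
def crossing (i : Fin n) : ℂ := D.curve (D.overTime i)

/-- The direction of the over strand at crossing `i`. -/
def overDir (i : Fin n) : ℂ := deriv D.curve (D.overTime i)

/-- The direction of the under strand at crossing `i`. -/
def underDir (i : Fin n) : ℂ := deriv D.curve (D.underTime i)

/-- The sign `σ i` of crossing `i`: `+1` if the under strand crosses the over strand from right to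
left, i.e. if (over direction, under direction) is a positive basis of the plane. -/
def σ (i : Fin n) : ℤ :=
  if 0 < (starRingEnd ℂ (D.overDir i) * D.underDir i).im then 1 else -1

/-- `d i = +1` if the ant goes over crossing `i` before it goes under it, and `-1` otherwise. -/
def d (i : Fin n) : ℤ := if D.overTime i < D.underTime i then 1 else -1

/-- `S(i) = σ i * d i`. -/
def S (i : Fin n) : ℤ := D.σ i * D.d i

/-- The first time at which the ant passes through crossing `i`. -/
def firstTime (i : Fin n) : ℝ := min (D.overTime i) (D.underTime i)

/-- The second time at which the ant passes through crossing `i`. -/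
def lastTime (i : Fin n) : ℝ := max (D.overTime i) (D.underTime i)

/-- The (open) time interval during which the ant walks along the span `Sp(i)`. -/
def spanTimes (i : Fin n) : Set ℝ := Set.Ioo (D.firstTime i) (D.lastTime i)

/-- A bounded region of the diagram: a bounded connected component of the complement of the
curve. -/
def BoundedRegion : Type :=
  {R : Set ℂ // (∃ z ∈ (Set.range D.curve)ᶜ,
    R = connectedComponentIn (Set.range D.curve)ᶜ z) ∧ Bornology.IsBounded R}

/-- The corners at crossing `i` are the four local sectors into which the two strands cut a
neighbourhood of the crossing. For `a, s = ±1`, the corner `(a, s)` is the one which the over strand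
has on its left (`s = 1`) or on its right (`s = -1`), after (`a = 1`) or before (`a = -1`) it passes
the under strand. The proposition says that this corner belongs to the region `R`.
(The vector `σ i • underDir i` points to the left of the over strand.) -/
def CornerIn (i : Fin n) (a s : ℤ) (R : Set ℂ) : Prop :=
  ∀ᶠ ε : ℝ in 𝓝[>] 0,
    D.crossing i + ε * (a * D.overDir i + s * D.σ i * D.underDir i) ∈ R

open Classical in
/-- The marking `m` of the corner `(a, s)` at crossing `i` if this corner belongs to `R`,
and `0` otherwise. -/
def cornerMark (i : Fin n) (a s : ℤ) (R : Set ℂ) (m : ℤ[T;T⁻¹]) : ℤ[T;T⁻¹] :=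
  if D.CornerIn i a s R then m else 0

/-- The indeterminate `x`, raised to the power `k`. -/
abbrev xpow (k : ℤ) : ℤ[T;T⁻¹] := LaurentPolynomial.T k

open Classical in
/-- The winding number of the region `R` with respect to the span `Sp(j)`: the integer which is
the winding number of every point of `R`. -/
def regionWinding (R : Set ℂ) (j : Fin n) : ℤ :=
  if h : ∃ k : ℤ, ∀ z ∈ R, IsClockwiseWindingNumber D.curve (D.firstTime j) (D.lastTime j) z k
  then h.choose else 0

/-- The Alexander matrix `A(K)`: the entry `(i, l)` is the marking of crossing `i` in region `l`.
Along the over strand the markings are first `-x`, then `x` on the right, and first `1`, then `-1`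
on the left. (If two corners of crossing `i` belong to the same region, their markings are added.) -/
def alexanderMatrix (ρ : Fin n ≃ D.BoundedRegion) : Matrix (Fin n) (Fin n) ℤ[T;T⁻¹] :=
  Matrix.of fun i l =>
    D.cornerMark i (-1) (-1) (ρ l).1 (-xpow 1) + D.cornerMark i 1 (-1) (ρ l).1 (xpow 1)
      + D.cornerMark i (-1) 1 (ρ l).1 1 + D.cornerMark i 1 1 (ρ l).1 (-1)

/-- The winding matrix `W(K)`. -/
def windingMatrix (ρ : Fin n ≃ D.BoundedRegion) : Matrix (Fin n) (Fin n) ℤ[T;T⁻¹] :=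
  Matrix.of fun l j => (D.regionWinding (ρ l).1 j : ℤ[T;T⁻¹])

open Classical in
/-- The matrix `T`: `T i j = 1` if the ant goes under crossing `j` as it walks along `Sp(i)`,
and `0` otherwise. -/
def TMatrix : Matrix (Fin n) (Fin n) ℤ[T;T⁻¹] :=
  Matrix.of fun i j => if D.underTime j ∈ D.spanTimes i then 1 else 0

/-- `Σ(K) = Diag(σ i)`. -/
def sigmaMatrix : Matrix (Fin n) (Fin n) ℤ[T;T⁻¹] := Matrix.diagonal fun i => (D.σ i : ℤ[T;T⁻¹])

/-- `S(K) = Diag(S(i))`. -/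
def SMatrix : Matrix (Fin n) (Fin n) ℤ[T;T⁻¹] := Matrix.diagonal fun i => (D.S i : ℤ[T;T⁻¹])

/-- `X^{-S} = Diag(x^{-S(i)})`. -/
def XNegS : Matrix (Fin n) (Fin n) ℤ[T;T⁻¹] := Matrix.diagonal fun i => xpow (-D.S i)

/-- `X^{-(1+S)/2} = Diag(x^{-(1+S(i))/2})`; the integer `1 + S(i)` is `0` or `2`. -/
def XNegHalf : Matrix (Fin n) (Fin n) ℤ[T;T⁻¹] :=
  Matrix.diagonal fun i => xpow (-((1 + D.S i) / 2))

end LongKnotDiagram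

end

/-!
The `(i, j)` entry of `A(K) W(K)` is the sum, over the four corners at crossing `i`, of the
marking of the corner times the winding number of `Sp(j)` around the points of the corner
(`LongKnotDiagram.eventually_sum_cornerMark`): winding numbers are constant on the regions, and
corners in unbounded regions, which do not occur in `A(K)`, have winding number `0`.

The two markings on either side of the over strand are opposite to each other, so the sum only
depends on the jumps of the winding number across the two halves of the under strand: the half
which leaves the crossing and the half which reaches it. The jump across a half is `σ i` if this
half belongs to `Sp(j)`, and `0` otherwise (`LongKnotDiagram.eventually_spanWinding_sub`). For `i
≠ j` both halves or none of them are in the span, according to `T j i`; for `i = j` exactly one of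
them is. The matrix identity follows from the formulas for the entries.

The jump is computed as follows (`IsClockwiseWindingNumber.sub_eq_one_of_crossing`). The
difference of the winding numbers around `z₁` and `z₂` is the total turning of `g = (γ - z₁) *
conj (γ - z₂)`, and `g ≤ 0` exactly when `γ` is on the segment from `z₁` to `z₂`. While `γ` avoids
the segment, the turning is measured by the principal argument of `g`; on the short time interval
where it traverses the segment, by the principal argument of `-g`. Switching between the two gives
`2π`. For half-strands at a crossing, differentiability there confines the curve to narrow cones
around the tangents, and properness keeps the rest of it away
(`LongKnotDiagram.exists_segment_crossing`).
-/

section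

open Complex ComplexConjugate Set

/-! ### Winding numbers of loops -/

/-- A continuous determination `φ` of the argument of a path which avoids the negative real axis has
the same increment as the principal argument: the two differ by a continuous function with values in
`2πℤ`. -/
theorem sub_eq_arg_sub_arg {g : ℝ → ℂ} {φ : ℝ → ℝ} {p q : ℝ} (hpq : p ≤ q)
    (hg : ContinuousOn g (Icc p q)) (hφ : ContinuousOn φ (Icc p q))
    (hs : ∀ t ∈ Icc p q, g t ∈ slitPlane)
    (hl : ∀ t ∈ Icc p q, g t = ‖g t‖ * exp (φ t * I)) :
    φ q - φ p = arg (g q) - arg (g p) := by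
  have hc : ContinuousOn (fun t => φ t - arg (g t)) (Icc p q) :=
    hφ.sub (continuousOn_arg.comp hg hs)
  have hm : MapsTo (fun t => φ t - arg (g t)) (Icc p q)
      (AddSubgroup.zmultiples (2 * Real.pi) : Set ℝ) := by
    intro t ht
    have h0 : g t ≠ 0 := slitPlane_ne_zero (hs t ht)
    have h1 : exp (φ t * I) = exp (arg (g t) * I) := by
      have h2 : (‖g t‖ : ℂ) ≠ 0 := by simpa using h0
      apply mul_left_cancel₀ h2
      rw [← hl t ht, norm_mul_exp_arg_mul_I]
    obtain ⟨n, hn⟩ := exp_eq_exp_iff_exists_int.1 h1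
    refine ⟨n, ?_⟩
    have h3 : (φ t : ℂ) * I = (arg (g t) + n * (2 * Real.pi) : ℝ) * I := by
      rw [hn]; push_cast; ring
    have h4 : φ t = arg (g t) + n * (2 * Real.pi) := by
      exact_mod_cast mul_right_cancel₀ I_ne_zero h3
    simp only [zsmul_eq_mul]
    rw [h4]; ring
  have h := isPreconnected_Icc.constant_of_mapsTo
    (⟨NormedSpace.discreteTopology_zmultiples _⟩) hc hm
    (left_mem_Icc.2 hpq) (right_mem_Icc.2 hpq)
  linarith

theorem exists_isClockwiseWindingNumber {γ : ℝ → ℂ} {a b : ℝ} {z : ℂ} (hab : a ≤ b)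
    (hγ : ContinuousOn γ (Icc a b)) (hz : ∀ t ∈ Icc a b, γ t ≠ z) (hcl : γ a = γ b) :
    ∃ k, IsClockwiseWindingNumber γ a b z k := by
  -- Lift the loop `γ - z`, extended by constants to all of `ℝ`, along the covering map `exp`.
  let f : C(ℝ, ℂ) := ⟨fun t => γ (projIcc a b hab t) - z, by
    have := hγ.domRestrict.comp (continuous_projIcc (h := hab))
    exact this.sub continuous_const⟩
  have hf : ∀ t, f t ≠ 0 := fun t => sub_ne_zero.2 (hz _ (projIcc a b hab t).2)
  obtain ⟨F, ⟨-, hF⟩, -⟩ := isCoveringMapOn_exp.existsUnique_continuousMap_lifts f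
    (a₀ := a) (exp_log (hf a)) hf
  have hFf : ∀ t ∈ Icc a b, γ t - z = exp (F t) := by
    intro t ht
    have h : exp (F t) = γ (projIcc a b hab t) - z := congrFun hF t
    rw [h, projIcc_of_mem hab ht]
  have hE : exp (F a) = exp (F b) := by
    rw [← hFf a (left_mem_Icc.2 hab), ← hFf b (right_mem_Icc.2 hab), hcl]
  obtain ⟨k, hk⟩ := exp_eq_exp_iff_exists_int.1 hE
  refine ⟨k, hz, fun t => (F t).im, by fun_prop, fun t ht => ?_, ?_⟩
  · rw [hFf t ht, norm_exp, ofReal_exp, ← exp_add, re_add_im]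
  · have := congrArg im hk
    simp at this
    simp only [this]; ring

namespace IsClockwiseWindingNumber

variable {γ : ℝ → ℂ} {a b : ℝ} {z z₁ z₂ : ℂ} {k k₁ k₂ : ℤ}

/-- The difference of the two angle functions is an angle function of
`(γ - z₁) * conj (γ - z₂)`. -/
theorem exists_lift_sub (h₁ : IsClockwiseWindingNumber γ a b z₁ k₁)
    (h₂ : IsClockwiseWindingNumber γ a b z₂ k₂) :
    ∃ φ : ℝ → ℝ, ContinuousOn φ (Icc a b) ∧
      (∀ t ∈ Icc a b, (γ t - z₁) * conj (γ t - z₂)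
        = ‖(γ t - z₁) * conj (γ t - z₂)‖ * exp (φ t * I)) ∧
      φ a - φ b = 2 * Real.pi * (k₁ - k₂) := by
  obtain ⟨-, θ₁, hc₁, hl₁, he₁⟩ := h₁
  obtain ⟨-, θ₂, hc₂, hl₂, he₂⟩ := h₂
  refine ⟨fun t => θ₁ t - θ₂ t, hc₁.sub hc₂, fun t ht => ?_, ?_⟩
  · have e : conj (γ t - z₂) = ‖γ t - z₂‖ * exp (-(θ₂ t * I)) := by
      conv_lhs => rw [hl₂ t ht]
      rw [map_mul, conj_ofReal, ← exp_conj]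
      simp
    rw [norm_mul, norm_conj]
    conv_lhs => rw [hl₁ t ht, e]
    push_cast
    rw [sub_mul, sub_eq_add_neg (_ * I), exp_add]
    ring
  · simp only
    linarith

/-- The hypothesis says that the loop does not meet the segment from `z₁` to `z₂`. -/
theorem eq_of_forall_mem_slitPlane (h₁ : IsClockwiseWindingNumber γ a b z₁ k₁)
    (h₂ : IsClockwiseWindingNumber γ a b z₂ k₂) (hab : a ≤ b) (hγ : ContinuousOn γ (Icc a b))
    (hcl : γ a = γ b) (hs : ∀ t ∈ Icc a b, (γ t - z₁) * conj (γ t - z₂) ∈ slitPlane) :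
    k₁ = k₂ := by
  obtain ⟨φ, hc, hl, he⟩ := h₁.exists_lift_sub h₂
  have hg : ContinuousOn (fun t => (γ t - z₁) * conj (γ t - z₂)) (Icc a b) := by fun_prop
  have := sub_eq_arg_sub_arg hab hg hc hs hl
  simp only [hcl, sub_self] at this
  have h : 2 * Real.pi * ((k₁ : ℝ) - k₂) = 0 := by linarith
  have h' : (k₁ : ℝ) - k₂ = 0 := by simpa [Real.pi_ne_zero] using h
  exact_mod_cast sub_eq_zero.1 h'

theorem unique (h₁ : IsClockwiseWindingNumber γ a b z k₁)
    (h₂ : IsClockwiseWindingNumber γ a b z k₂) (hab : a ≤ b) (hγ : ContinuousOn γ (Icc a b))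
    (hcl : γ a = γ b) : k₁ = k₂ := by
  refine h₁.eq_of_forall_mem_slitPlane h₂ hab hγ hcl fun t ht => ?_
  rw [mul_conj, ofReal_mem_slitPlane]
  exact normSq_pos.2 (sub_ne_zero.2 (h₁.1 t ht))

/-- A loop which stays in a disc not containing `z` does not wind around `z`. -/
theorem eq_zero_of_norm_lt (h : IsClockwiseWindingNumber γ a b z k) (hab : a ≤ b)
    (hγ : ContinuousOn γ (Icc a b)) (hcl : γ a = γ b) (hz : ∀ t ∈ Icc a b, ‖γ t‖ < ‖z‖) :
    k = 0 := by
  obtain ⟨-, θ, hc, hl, he⟩ := h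
  -- Multiplication by `conj (-z)` turns the loop into the right half-plane.
  have hg : ContinuousOn (fun t => (γ t - z) * conj (-z)) (Icc a b) := by fun_prop
  have := sub_eq_arg_sub_arg (φ := fun t => θ t - arg (-z)) hab hg (by fun_prop)
    (fun t ht => ?_) (fun t ht => ?_)
  · simp only [hcl, sub_self] at this
    have h : 2 * Real.pi * (k : ℝ) = 0 := by linarith
    simpa [Real.pi_ne_zero] using h
  · left
    have e : ((γ t - z) * conj (-z)).re = ‖z‖ ^ 2 - (γ t * conj z).re := by
      rw [← normSq_eq_norm_sq, normSq_apply]; simp; ring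
    rw [e]
    have h1 : (γ t * conj z).re ≤ ‖γ t‖ * ‖z‖ := by
      simpa using re_le_norm (γ t * conj z)
    have h2 := hz t ht
    have h3 := norm_nonneg (γ t)
    nlinarith
  · have e : conj (-z) = ‖z‖ * exp (-(arg (-z) * I)) := by
      conv_lhs => rw [← norm_mul_exp_arg_mul_I (-z)]
      rw [map_mul, conj_ofReal, ← exp_conj, norm_neg]
      simp
    rw [norm_mul, norm_conj, norm_neg]
    conv_lhs => rw [hl t ht, e]
    push_cast
    rw [sub_mul, sub_eq_add_neg (_ * I), exp_add]
    ring

/-- The winding number jumps by one when the loop crosses the segment from `z₁` to `z₂` exactly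
once. With `g = (γ - z₁) * conj (γ - z₂)`, the loop is on that segment when `g ≤ 0` and on the rest
of the line through `z₁` and `z₂` when `0 < g`; the sign of `im g` tells the side of that line. -/
theorem sub_eq_one_of_crossing (h₁ : IsClockwiseWindingNumber γ a b z₁ k₁)
    (h₂ : IsClockwiseWindingNumber γ a b z₂ k₂) (hγ : ContinuousOn γ (Icc a b))
    (hcl : γ a = γ b) {p q : ℝ} (hap : a ≤ p) (hpq : p ≤ q) (hqb : q ≤ b)
    (hs : ∀ t ∈ Icc a p ∪ Icc q b, (γ t - z₁) * conj (γ t - z₂) ∈ slitPlane)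
    (hs' : ∀ t ∈ Icc p q, -((γ t - z₁) * conj (γ t - z₂)) ∈ slitPlane)
    (hp : ((γ p - z₁) * conj (γ p - z₂)).im < 0)
    (hq : 0 < ((γ q - z₁) * conj (γ q - z₂)).im) :
    k₁ - k₂ = 1 := by
  obtain ⟨φ, hc, hl, he⟩ := h₁.exists_lift_sub h₂
  have hg : ContinuousOn (fun t => (γ t - z₁) * conj (γ t - z₂)) (Icc a b) := by fun_prop
  have s₁ : Icc a p ⊆ Icc a b := Icc_subset_Icc_right (hpq.trans hqb)
  have s₂ : Icc p q ⊆ Icc a b := Icc_subset_Icc hap hqb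
  have s₃ : Icc q b ⊆ Icc a b := Icc_subset_Icc_left (hap.trans hpq)
  have e₁ := sub_eq_arg_sub_arg hap (hg.mono s₁) (hc.mono s₁) (fun t ht => hs t (.inl ht))
    (fun t ht => hl t (s₁ ht))
  have e₂ := sub_eq_arg_sub_arg (g := fun t => -((γ t - z₁) * conj (γ t - z₂)))
    (φ := fun t => φ t + Real.pi) hpq (hg.mono s₂).neg
    ((hc.mono s₂).add continuousOn_const) hs' (fun t ht => by
      -- As `exp (π I) = -1`, `φ + π` is an angle function of `-g`.
      simp only [norm_neg, ofReal_add]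
      rw [add_mul, exp_add, exp_pi_mul_I]
      conv_lhs => rw [hl t (s₂ ht)]
      ring)
  have e₃ := sub_eq_arg_sub_arg hqb (hg.mono s₃) (hc.mono s₃) (fun t ht => hs t (.inr ht))
    (fun t ht => hl t (s₃ ht))
  -- Passing between `arg g` and `arg (-g)` costs `π` at both ends, with opposite signs.
  simp only [arg_neg_eq_arg_sub_pi_of_im_pos hq, arg_neg_eq_arg_add_pi_of_im_neg hp] at e₂
  simp only [hcl] at e₁
  have h : 2 * Real.pi * ((k₁ : ℝ) - k₂ - 1) = 0 := by linarith
  have h' : (k₁ : ℝ) - k₂ - 1 = 0 := by simpa [Real.pi_ne_zero] using h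
  have h'' : (k₁ : ℝ) - k₂ = 1 := by linarith
  exact_mod_cast h''

end IsClockwiseWindingNumber

/-! ### The curve near a crossing -/

/-- In the basis `(o, u)`, consider the point with coordinates `(X, Y)` and the segment from
`(ε, 0)` to `(-ε, 0)`. If the point is not on this segment, then the product below, whose argument
is the angle under which the segment is seen from the point, is not a real number `≤ 0`. -/
theorem mul_conj_mem_slitPlane {o u : ℂ} {X Y ε : ℝ} (hκ : (conj o * u).im ≠ 0) (hε : 0 < ε)
    (h : Y ≠ 0 ∨ ε < |X|) :
    ((X - ε) * o + Y * u) * conj ((X + ε) * o + Y * u) ∈ slitPlane := by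
  rw [mem_slitPlane_iff]
  by_cases hY : Y = 0
  · left
    have hX := sq_lt_sq' (by linarith [abs_nonneg X]) (h.resolve_left (not_not.2 hY))
    have ho : 0 < normSq o := normSq_pos.2 fun h0 => hκ (by simp [h0])
    rw [sq_abs] at hX
    have e : (((X - ε) * o + Y * u) * conj ((X + ε) * o + Y * u) : ℂ).re
        = (X ^ 2 - ε ^ 2) * normSq o := by
      rw [normSq_apply]; simp [hY]; ring
    rw [e]
    exact mul_pos (by linarith) ho
  · right
    have e : (((X - ε) * o + Y * u) * conj ((X + ε) * o + Y * u) : ℂ).im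
        = 2 * ε * Y * (conj o * u).im := by
      simp; ring
    rw [e]
    positivity

/-- In the situation of `mul_conj_mem_slitPlane`, the product is not a real number `≥ 0`
unless the point is on the line through the segment, but not in the interior of the segment. -/
theorem neg_mul_conj_mem_slitPlane {o u : ℂ} {X Y ε : ℝ} (hκ : (conj o * u).im ≠ 0)
    (hε : 0 < ε) (h : Y ≠ 0 ∨ |X| < ε) :
    -(((X - ε) * o + Y * u) * conj ((X + ε) * o + Y * u)) ∈ slitPlane := by
  rw [mem_slitPlane_iff]
  by_cases hY : Y = 0
  · left
    have hX := sq_lt_sq' (by linarith [abs_nonneg X]) (h.resolve_left (not_not.2 hY))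
    have ho : 0 < normSq o := normSq_pos.2 fun h0 => hκ (by simp [h0])
    rw [sq_abs] at hX
    have e : (-(((X - ε) * o + Y * u) * conj ((X + ε) * o + Y * u)) : ℂ).re
        = (ε ^ 2 - X ^ 2) * normSq o := by
      rw [normSq_apply]; simp [hY]; ring
    rw [e]
    exact mul_pos (by linarith) ho
  · right
    have e : (-(((X - ε) * o + Y * u) * conj ((X + ε) * o + Y * u)) : ℂ).im
        = -(2 * ε * Y * (conj o * u).im) := by
      simp; ring
    rw [e, neg_ne_zero]
    positivity

theorem exists_abs_sub_le_of_differentiableAt {γ : ℝ → ℂ} {t₀ : ℝ}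
    (h : DifferentiableAt ℝ γ t₀) (L : ℂ →L[ℝ] ℝ) :
    ∃ δ > 0, ∀ t, |t - t₀| ≤ δ →
      |L (γ t - γ t₀) - (t - t₀) * L (deriv γ t₀)| ≤ |t - t₀| / 4 := by
  have hd : HasDerivAt (fun t => L (γ t)) (L (deriv γ t₀)) t₀ :=
    L.hasFDerivAt.comp_hasDerivAt t₀ h.hasDerivAt
  have hb := hd.isLittleO.bound (show (0 : ℝ) < 1 / 4 by norm_num)
  obtain ⟨δ, hδ, H⟩ := Metric.eventually_nhds_iff.1 hb
  refine ⟨δ / 2, by positivity, fun t ht => ?_⟩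
  have := H (y := t) (by rw [Real.dist_eq]; linarith)
  simp only [Real.norm_eq_abs, smul_eq_mul] at this
  rw [map_sub]
  linarith

namespace LongKnotDiagram

variable {n : ℕ} (D : LongKnotDiagram n) (i : Fin n)

/-- The determinant of the over direction and the under direction at crossing `i`; its sign is
`σ i`. -/
noncomputable def dirDet : ℝ := (conj (D.overDir i) * D.underDir i).im

theorem dirDet_ne_zero : D.dirDet i ≠ 0 := D.transverse i

/-- The first coordinate in the basis `(overDir i, underDir i)` of the plane. -/
noncomputable def overCoord : ℂ →L[ℝ] ℝ :=
  (-(D.dirDet i)⁻¹) • (imCLM ∘L ContinuousLinearMap.mul ℝ ℂ (conj (D.underDir i)))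

/-- The second coordinate in the basis `(overDir i, underDir i)` of the plane. -/
noncomputable def underCoord : ℂ →L[ℝ] ℝ :=
  (D.dirDet i)⁻¹ • (imCLM ∘L ContinuousLinearMap.mul ℝ ℂ (conj (D.overDir i)))

theorem overCoord_apply (w : ℂ) :
    D.overCoord i w = -(D.dirDet i)⁻¹ * (conj (D.underDir i) * w).im := rfl

theorem underCoord_apply (w : ℂ) :
    D.underCoord i w = (D.dirDet i)⁻¹ * (conj (D.overDir i) * w).im := rfl

theorem dirDet_eq : D.dirDet i =
    (D.overDir i).re * (D.underDir i).im - (D.overDir i).im * (D.underDir i).re := by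
  simp [dirDet]; ring

theorem overCoord_add_underCoord (w : ℂ) :
    (D.overCoord i w : ℂ) * D.overDir i + D.underCoord i w * D.underDir i = w := by
  have h := D.dirDet_ne_zero i
  have e := D.dirDet_eq i
  apply Complex.ext
  · simp only [overCoord_apply, underCoord_apply, add_re, mul_re, ofReal_re, ofReal_im, mul_im,
      conj_re, conj_im]
    field_simp
    rw [e]; ring
  · simp only [overCoord_apply, underCoord_apply, add_im, ofReal_re, ofReal_im, mul_im, conj_re, conj_im]
    field_simp
    rw [e]; ring

theorem overCoord_eq (x y : ℝ) :
    D.overCoord i (x * D.overDir i + y * D.underDir i) = x := by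
  have h := D.dirDet_ne_zero i
  simp only [overCoord_apply, mul_im, add_re, add_im, mul_re, ofReal_re, ofReal_im,
    conj_re, conj_im]
  field_simp
  rw [D.dirDet_eq i]; ring

theorem underCoord_eq (x y : ℝ) :
    D.underCoord i (x * D.overDir i + y * D.underDir i) = y := by
  have h := D.dirDet_ne_zero i
  simp only [underCoord_apply, mul_im, add_re, add_im, mul_re, ofReal_re, ofReal_im,
    conj_re, conj_im]
  field_simp
  rw [D.dirDet_eq i]; ring

theorem isClosedMap_curve : IsClosedMap D.curve :=
  (isProperMap_iff_tendsto_cocompact.2 ⟨D.continuous_curve, D.proper_curve⟩).isClosedMap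

theorem isOpen_compl_range : IsOpen (range D.curve)ᶜ :=
  D.isClosedMap_curve.isClosed_range.isOpen_compl

theorem curve_ne_crossing {t : ℝ} (ho : t ≠ D.overTime i) (hu : t ≠ D.underTime i) :
    D.curve t ≠ D.crossing i := by
  intro h
  obtain ⟨j, ⟨h1, h2⟩ | ⟨h1, h2⟩⟩ := D.exists_crossing t (D.overTime i) ho h
  · have : i = j := D.crossing_injective (by simp only [h2, D.curve_over_eq_under])
    exact ho (this ▸ h1)
  · have : i = j := D.crossing_injective (by simp only [h2])
    exact hu (this ▸ h1)

/-- Except shortly before and after its two passages, the curve stays away from the crossing, because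
it is proper. -/
theorem exists_le_abs_coord {δ : ℝ} (hδ : 0 < δ) :
    ∃ r > 0, ∀ t, δ ≤ |t - D.overTime i| → δ ≤ |t - D.underTime i| →
      r ≤ |D.overCoord i (D.curve t - D.crossing i)| ∨
      r ≤ |D.underCoord i (D.curve t - D.crossing i)| := by
  have hC : IsClosed {t : ℝ | δ ≤ |t - D.overTime i| ∧ δ ≤ |t - D.underTime i|} :=
    (isClosed_le (f := fun _ => δ) (g := fun t => |t - D.overTime i|) (by fun_prop)
      (by fun_prop)).inter
    (isClosed_le (f := fun _ => δ) (g := fun t => |t - D.underTime i|) (by fun_prop) (by fun_prop))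
  have hm : D.crossing i ∈
      (D.curve '' {t : ℝ | δ ≤ |t - D.overTime i| ∧ δ ≤ |t - D.underTime i|})ᶜ := by
    rintro ⟨t, ⟨h1, h2⟩, h⟩
    refine D.curve_ne_crossing i ?_ ?_ h <;> rintro rfl <;> simp at h1 h2 <;> linarith
  obtain ⟨R, hR, hb⟩ := Metric.isOpen_iff.1 (D.isClosedMap_curve _ hC).isOpen_compl _ hm
  have hN : 0 < ‖D.overDir i‖ + ‖D.underDir i‖ + 1 := by positivity
  refine ⟨R / (‖D.overDir i‖ + ‖D.underDir i‖ + 1), by positivity, fun t h1 h2 => ?_⟩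
  by_contra! hlt
  obtain ⟨hX, hY⟩ := hlt
  refine hb ?_ (mem_image_of_mem _ (show t ∈ {t : ℝ | _} from ⟨h1, h2⟩))
  rw [Metric.mem_ball, dist_eq, ← D.overCoord_add_underCoord i (D.curve t - D.crossing i)]
  refine (norm_add_le _ _).trans_lt ?_
  rw [norm_mul, norm_mul, norm_real, norm_real, Real.norm_eq_abs, Real.norm_eq_abs]
  have h3 := mul_le_mul_of_nonneg_right hX.le (norm_nonneg (D.overDir i))
  have h4 := mul_le_mul_of_nonneg_right hY.le (norm_nonneg (D.underDir i))
  have h5 : R / (‖D.overDir i‖ + ‖D.underDir i‖ + 1) * (‖D.overDir i‖ + ‖D.underDir i‖ + 1) = R :=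
    div_mul_cancel₀ _ hN.ne'
  have h6 : 0 < R / (‖D.overDir i‖ + ‖D.underDir i‖ + 1) := by positivity
  linarith

/-- Near a crossing, the curve stays in narrow double cones around its two tangents. -/
theorem exists_local_form : ∃ δ > 0,
    (∀ t, |t - D.overTime i| ≤ δ →
      |D.overCoord i (D.curve t - D.crossing i) - (t - D.overTime i)| ≤ |t - D.overTime i| / 4 ∧
      |D.underCoord i (D.curve t - D.crossing i)| ≤ |t - D.overTime i| / 4) ∧
    (∀ t, |t - D.underTime i| ≤ δ →
      |D.overCoord i (D.curve t - D.crossing i)| ≤ |t - D.underTime i| / 4 ∧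
      |D.underCoord i (D.curve t - D.crossing i) - (t - D.underTime i)|
        ≤ |t - D.underTime i| / 4) := by
  have oo : D.overCoord i (deriv D.curve (D.overTime i)) = 1 := by
    simpa [overDir] using D.overCoord_eq i 1 0
  have uo : D.underCoord i (deriv D.curve (D.overTime i)) = 0 := by
    simpa [overDir] using D.underCoord_eq i 1 0
  have ou : D.overCoord i (deriv D.curve (D.underTime i)) = 0 := by
    simpa [underDir] using D.overCoord_eq i 0 1
  have uu : D.underCoord i (deriv D.curve (D.underTime i)) = 1 := by
    simpa [underDir] using D.underCoord_eq i 0 1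
  obtain ⟨δ₁, p₁, h₁⟩ := exists_abs_sub_le_of_differentiableAt (D.differentiableAt_over i)
    (D.overCoord i)
  obtain ⟨δ₂, p₂, h₂⟩ := exists_abs_sub_le_of_differentiableAt (D.differentiableAt_over i)
    (D.underCoord i)
  obtain ⟨δ₃, p₃, h₃⟩ := exists_abs_sub_le_of_differentiableAt (D.differentiableAt_under i)
    (D.overCoord i)
  obtain ⟨δ₄, p₄, h₄⟩ := exists_abs_sub_le_of_differentiableAt (D.differentiableAt_under i)
    (D.underCoord i)
  rw [oo] at h₁
  rw [uo] at h₂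
  rw [ou, ← D.curve_over_eq_under] at h₃
  rw [uu, ← D.curve_over_eq_under] at h₄
  simp only [mul_one, mul_zero, sub_zero] at h₁ h₂ h₃ h₄
  refine ⟨min (min δ₁ δ₂) (min δ₃ δ₄), by positivity, fun t ht => ?_, fun t ht => ?_⟩ <;>
    simp only [le_inf_iff] at ht
  · exact ⟨h₁ t ht.1.1, h₂ t ht.1.2⟩
  · exact ⟨h₃ t ht.2.1, h₄ t ht.2.2⟩

/-- The point near crossing `i` with coordinates `ε * α` and `ε * β` in the basis
`(overDir i, underDir i)`. -/
noncomputable def nearPoint (α β ε : ℝ) : ℂ :=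
  D.crossing i + ε * (α * D.overDir i + β * D.underDir i)

theorem sub_nearPoint (α β ε : ℝ) (z : ℂ) :
    z - D.nearPoint i α β ε = ((D.overCoord i (z - D.crossing i) - ε * α : ℝ) : ℂ) * D.overDir i
      + ((D.underCoord i (z - D.crossing i) - ε * β : ℝ) : ℂ) * D.underDir i := by
  have := D.overCoord_add_underCoord i (z - D.crossing i)
  rw [nearPoint]
  push_cast
  linear_combination -this

theorem exists_nearPoint_notMem_range {α β : ℝ} (hα : |α| = 1) (hβ : |β| = 1) :
    ∃ ε₀ > 0, ∀ ε ∈ Ioo 0 ε₀, D.nearPoint i α β ε ∈ (range D.curve)ᶜ := by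
  obtain ⟨δ, hδ, ho, hu⟩ := D.exists_local_form i
  obtain ⟨r, hr, hf⟩ := D.exists_le_abs_coord i hδ
  refine ⟨r, hr, fun ε ⟨hε, hεr⟩ ⟨t, ht⟩ => ?_⟩
  have hc : D.curve t - D.crossing i
      = ((ε * α : ℝ) : ℂ) * D.overDir i + ((ε * β : ℝ) : ℂ) * D.underDir i := by
    rw [ht, nearPoint]; push_cast; ring
  have hX : D.overCoord i (D.curve t - D.crossing i) = ε * α := by rw [hc, D.overCoord_eq]
  have hY : D.underCoord i (D.curve t - D.crossing i) = ε * β := by rw [hc, D.underCoord_eq]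
  have hX' : |ε * α| = ε := by rw [abs_mul, hα, mul_one, abs_of_pos hε]
  have hY' : |ε * β| = ε := by rw [abs_mul, hβ, mul_one, abs_of_pos hε]
  rcases le_total |t - D.overTime i| δ with h1 | h1
  · obtain ⟨h2, h3⟩ := ho t h1
    rw [hX] at h2
    rw [hY, hY'] at h3
    have := abs_sub_abs_le_abs_sub (t - D.overTime i) (ε * α)
    rw [abs_sub_comm _ (ε * α), hX'] at this
    linarith
  rcases le_total |t - D.underTime i| δ with h4 | h4
  · obtain ⟨h2, h3⟩ := hu t h4
    rw [hY] at h3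
    rw [hX, hX'] at h2
    have := abs_sub_abs_le_abs_sub (t - D.underTime i) (ε * β)
    rw [abs_sub_comm _ (ε * β), hY'] at this
    linarith
  · have := hf t h1 h4
    rw [hX, hY, hX', hY'] at this
    rcases this with h | h <;> linarith

/-- A short segment, parallel to the over strand, which crosses the half of the under strand that
leaves (`η = 1`) or reaches (`η = -1`) crossing `i`, meets the curve only at times between the passage
under the crossing and the time `δ` after (or before) it, and at these two times the curve is on
different sides of the line through the segment. The conclusions have the form required by
`IsClockwiseWindingNumber.sub_eq_one_of_crossing`. -/
theorem exists_segment_crossing : ∃ δ₀ > 0, ∀ δ, 0 < δ → δ ≤ δ₀ → ∀ η : ℝ, η = 1 ∨ η = -1 →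
    ∀ᶠ ε in 𝓝[>] (0 : ℝ), ∀ g : ℝ → ℂ,
      (g = fun t => (D.curve t - D.nearPoint i 1 η ε) * conj (D.curve t - D.nearPoint i (-1) η ε)) →
      (∀ t, 0 ≤ η * (t - D.underTime i) → η * (t - D.underTime i) ≤ δ → -g t ∈ slitPlane) ∧
      (∀ t, η * (t - D.underTime i) ≤ 0 ∨ δ ≤ η * (t - D.underTime i) → g t ∈ slitPlane) ∧
      (g (D.underTime i)).im * (η * D.dirDet i) < 0 ∧
      0 < (g (D.underTime i + η * δ)).im * (η * D.dirDet i) := by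
  obtain ⟨δ₀, hδ₀, ho, hu⟩ := D.exists_local_form i
  refine ⟨δ₀, hδ₀, fun δ hδ hδδ η hη => ?_⟩
  obtain ⟨r, hr, hf⟩ := D.exists_le_abs_coord i hδ
  have hmem : Ioo 0 (min r (δ / 2)) ∈ 𝓝[>] (0 : ℝ) := Ioo_mem_nhdsGT (by positivity)
  filter_upwards [hmem] with ε ⟨hε, hεm⟩ g hg
  obtain ⟨hεr, hεδ⟩ := lt_min_iff.1 hεm
  set X : ℝ → ℝ := fun t => D.overCoord i (D.curve t - D.crossing i) with hX
  set Y : ℝ → ℝ := fun t => D.underCoord i (D.curve t - D.crossing i) with hY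
  have hgt : ∀ t, g t = ((X t - ε) * D.overDir i + (Y t - ε * η : ℝ) * D.underDir i) *
      conj ((X t + ε) * D.overDir i + (Y t - ε * η : ℝ) * D.underDir i) := by
    intro t
    rw [hg]
    simp only
    rw [sub_nearPoint, sub_nearPoint]
    simp only [hX, hY]
    push_cast
    ring_nf
  have him : ∀ t, (g t).im = 2 * ε * (Y t - ε * η) * D.dirDet i := by
    intro t
    rw [hgt, dirDet_eq]
    simp
    ring
  have hκ := D.dirDet_ne_zero i
  -- At time `δ` after (before) the crossing the curve is beyond the segment, as `ε < δ / 2`.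
  have hYend : δ * (3 / 4) ≤ η * Y (D.underTime i + η * δ) := by
    have h1 : |D.underTime i + η * δ - D.underTime i| = δ := by
      rcases hη with rfl | rfl <;> simp [abs_of_pos hδ]
    have h2 := (hu (D.underTime i + η * δ) (h1.trans_le hδδ)).2
    rw [h1] at h2
    have h3 := abs_le.1 h2
    simp only [hY]
    rcases hη with rfl | rfl <;> linarith [h3.1, h3.2]
  have hη2 : η * η = 1 := by rcases hη with rfl | rfl <;> norm_num
  refine ⟨fun t h0 h1 => ?_, fun t ht => ?_, ?_, ?_⟩
  · rw [hgt]
    refine neg_mul_conj_mem_slitPlane hκ hε ?_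
    -- In the cone around the under strand, `Y = ± ε` forces `|X| ≤ ε / 3`.
    by_contra! hcon
    obtain ⟨hc1, hc2⟩ := hcon
    have habs : |t - D.underTime i| = η * (t - D.underTime i) := by
      rcases hη with rfl | rfl
      · rw [abs_of_nonneg] <;> linarith
      · rw [abs_of_nonpos] <;> linarith
    obtain ⟨h2, h3⟩ := hu t (by linarith)
    rw [habs] at h2 h3
    change |X t| ≤ _ at h2
    change |Y t - _| ≤ _ at h3
    have h4 := abs_le.1 h3
    rcases hη with rfl | rfl <;> linarith [h4.1, h4.2]
  · rw [hgt]
    refine mul_conj_mem_slitPlane hκ hε ?_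
    by_contra! hcon
    -- The curve is on the segment at time `t`.
    obtain ⟨hc1, hc2⟩ := hcon
    have hYt : |Y t| = ε := by
      rw [show Y t = ε * η by linarith]
      rcases hη with rfl | rfl <;> simp [abs_of_pos hε]
    -- In the cone around the over strand, `|Y| = ε` forces `|X| ≥ 3 * ε`.
    rcases le_total |t - D.overTime i| δ with h1 | h1
    · obtain ⟨h2, h3⟩ := ho t (h1.trans hδδ)
      change |X t - _| ≤ _ at h2
      change |Y t| ≤ _ at h3
      have := abs_sub_abs_le_abs_sub (t - D.overTime i) (X t)
      rw [abs_sub_comm _ (X t)] at this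
      linarith
    -- On the other half of the under strand, the sign of `Y` is wrong.
    rcases lt_or_ge |t - D.underTime i| δ with h4 | h4
    · have h5 := (hu t (h4.le.trans hδδ)).2
      change |Y t - _| ≤ _ at h5
      obtain ⟨h6, h7⟩ := abs_lt.1 h4
      have h8 : η * (t - D.underTime i) ≤ 0 := by
        rcases ht with ht | ht
        · exact ht
        · rcases hη with rfl | rfl <;> linarith
      have habs : |t - D.underTime i| = -(η * (t - D.underTime i)) := by
        rcases hη with rfl | rfl
        · rw [abs_of_nonpos] <;> linarith
        · rw [abs_of_nonneg] <;> linarith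
      rw [habs] at h5
      have h9 := abs_le.1 h5
      rcases hη with rfl | rfl <;> linarith [h9.1, h9.2]
    · rcases hf t h1 h4 with h | h
      · change r ≤ |X t| at h
        linarith
      · change r ≤ |Y t| at h
        linarith
  · have h0 : Y (D.underTime i) = 0 := by
      simp [hY, crossing, D.curve_over_eq_under]
    rw [him, h0]
    have : 2 * ε * (0 - ε * η) * D.dirDet i * (η * D.dirDet i)
        = -(2 * ε ^ 2 * D.dirDet i ^ 2) * (η * η) := by ring
    rw [this, hη2]
    have : 0 < 2 * ε ^ 2 * D.dirDet i ^ 2 := by positivity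
    linarith
  · rw [him]
    have : 2 * ε * (Y (D.underTime i + η * δ) - ε * η) * D.dirDet i * (η * D.dirDet i)
        = 2 * ε * D.dirDet i ^ 2 * (η * Y (D.underTime i + η * δ) - ε * (η * η)) := by ring
    rw [this, hη2]
    have : 0 < η * Y (D.underTime i + η * δ) - ε * 1 := by linarith
    positivity

end LongKnotDiagram

namespace LongKnotDiagram

variable {n : ℕ} (D : LongKnotDiagram n)

/-! ### Winding numbers with respect to a span -/

theorem firstTime_le_lastTime (j : Fin n) : D.firstTime j ≤ D.lastTime j := min_le_max

theorem curve_firstTime_eq (j : Fin n) : D.curve (D.firstTime j) = D.curve (D.lastTime j) := by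
  rcases le_total (D.overTime j) (D.underTime j) with h | h <;>
    simp [firstTime, lastTime, h, D.curve_over_eq_under]

open Classical in
/-- The clockwise winding number of the span `Sp(j)` around the point `z`; it is `0` by convention
when `z` lies on the span. -/
noncomputable def spanWinding (j : Fin n) (z : ℂ) : ℤ :=
  if h : ∃ k : ℤ, IsClockwiseWindingNumber D.curve (D.firstTime j) (D.lastTime j) z k
  then h.choose else 0

theorem spanWinding_spec (j : Fin n) {z : ℂ} (hz : z ∈ (range D.curve)ᶜ) :
    IsClockwiseWindingNumber D.curve (D.firstTime j) (D.lastTime j) z (D.spanWinding j z) := by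
  have h := exists_isClockwiseWindingNumber (D.firstTime_le_lastTime j)
    D.continuous_curve.continuousOn (z := z) (fun t _ h => hz ⟨t, h⟩) (D.curve_firstTime_eq j)
  rw [spanWinding, dif_pos h]
  exact h.choose_spec

theorem spanWinding_eq {j : Fin n} {z : ℂ} {k : ℤ} (hz : z ∈ (range D.curve)ᶜ)
    (h : IsClockwiseWindingNumber D.curve (D.firstTime j) (D.lastTime j) z k) :
    D.spanWinding j z = k :=
  (D.spanWinding_spec j hz).unique h (D.firstTime_le_lastTime j) D.continuous_curve.continuousOn
    (D.curve_firstTime_eq j)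

theorem continuousOn_spanWinding (j : Fin n) :
    ContinuousOn (D.spanWinding j) (range D.curve)ᶜ := by
  intro z hz
  obtain ⟨r, hr, hb⟩ := Metric.isOpen_iff.1 D.isOpen_compl_range z hz
  refine ContinuousAt.continuousWithinAt ?_
  refine continuousAt_const.congr (f := fun _ => D.spanWinding j z) ?_
  filter_upwards [Metric.ball_mem_nhds z hr] with w hw
  refine (D.spanWinding_spec j hz).eq_of_forall_mem_slitPlane (D.spanWinding_spec j (hb hw))
    (D.firstTime_le_lastTime j) D.continuous_curve.continuousOn (D.curve_firstTime_eq j)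
    fun t _ => Or.inl ?_
  have h1 : ‖w - z‖ < ‖D.curve t - z‖ := by
    by_contra! hcon
    refine hb (a := D.curve t) ?_ ⟨t, rfl⟩
    rw [Metric.mem_ball, dist_eq] at hw ⊢
    exact hcon.trans_lt hw
  have e : ((D.curve t - z) * conj (D.curve t - w)).re
      = ‖D.curve t - z‖ ^ 2 - ((D.curve t - z) * conj (w - z)).re := by
    rw [← normSq_eq_norm_sq, normSq_apply]; simp; ring
  rw [e]
  have h2 : ((D.curve t - z) * conj (w - z)).re ≤ ‖D.curve t - z‖ * ‖w - z‖ := by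
    simpa only [norm_mul, norm_conj] using re_le_norm ((D.curve t - z) * conj (w - z))
  have h3 := norm_nonneg (w - z)
  nlinarith

theorem spanWinding_eq_of_mem_component {j : Fin n} {z w : ℂ}
    (hw : w ∈ connectedComponentIn (range D.curve)ᶜ z) :
    D.spanWinding j w = D.spanWinding j z := by
  have hz : z ∈ (range D.curve)ᶜ := connectedComponentIn_nonempty_iff.1 ⟨w, hw⟩
  exact isPreconnected_connectedComponentIn.constant
    ((D.continuousOn_spanWinding j).mono (connectedComponentIn_subset _ _)) hw
    (mem_connectedComponentIn hz)

theorem regionWinding_component (j : Fin n) {z : ℂ} (hz : z ∈ (range D.curve)ᶜ) :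
    D.regionWinding (connectedComponentIn (range D.curve)ᶜ z) j = D.spanWinding j z := by
  have h : ∃ k : ℤ, ∀ w ∈ connectedComponentIn (range D.curve)ᶜ z,
      IsClockwiseWindingNumber D.curve (D.firstTime j) (D.lastTime j) w k :=
    ⟨D.spanWinding j z, fun w hw => D.spanWinding_eq_of_mem_component hw ▸
      D.spanWinding_spec j (connectedComponentIn_subset _ _ hw)⟩
  rw [regionWinding, dif_pos h]
  exact (D.spanWinding_eq hz (h.choose_spec z (mem_connectedComponentIn hz))).symm

theorem spanWinding_eq_zero_of_not_isBounded (j : Fin n) {z : ℂ}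
    (hb : ¬ Bornology.IsBounded (connectedComponentIn (range D.curve)ᶜ z)) :
    D.spanWinding j z = 0 := by
  obtain ⟨M, hM⟩ := (isCompact_Icc (a := D.firstTime j)
    (b := D.lastTime j)).exists_bound_of_continuousOn D.continuous_curve.continuousOn
  obtain ⟨w, hw, hwM⟩ : ∃ w ∈ connectedComponentIn (range D.curve)ᶜ z, M < ‖w‖ := by
    by_contra! h
    exact hb (isBounded_iff_forall_norm_le.2 ⟨M, h⟩)
  rw [← D.spanWinding_eq_of_mem_component hw]
  exact (D.spanWinding_spec j (connectedComponentIn_subset _ _ hw)).eq_zero_of_norm_lt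
    (D.firstTime_le_lastTime j) D.continuous_curve.continuousOn (D.curve_firstTime_eq j)
    fun t ht => (hM t ht).trans_lt hwM

/-- The half of the under strand at crossing `i` which leaves (`η = 1`) or reaches (`η = -1`) the
crossing belongs to the span `Sp(j)`. For `i = j` this holds for exactly one of the two halves. -/
def HalfUnderInSpan (i j : Fin n) (η : ℝ) : Prop :=
  (η = 1 ∧ D.underTime i ∈ Ico (D.firstTime j) (D.lastTime j)) ∨
  (η = -1 ∧ D.underTime i ∈ Ioc (D.firstTime j) (D.lastTime j))

open Classical in
/-- The winding number jumps by `σ i` across a half of the under strand at crossing `i` which is in the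
span, since the over direction points to the right of the under strand when `σ i = 1`. -/
theorem eventually_spanWinding_sub (i j : Fin n) {η : ℝ} (hη : η = 1 ∨ η = -1) :
    ∀ᶠ ε in 𝓝[>] (0 : ℝ),
      D.spanWinding j (D.nearPoint i 1 η ε) - D.spanWinding j (D.nearPoint i (-1) η ε)
        = if D.HalfUnderInSpan i j η then D.σ i else 0 := by
  obtain ⟨δ₀, hδ₀, H⟩ := D.exists_segment_crossing i
  have hη1 : |η| = 1 := by rcases hη with rfl | rfl <;> simp
  obtain ⟨ε₁, hε₁, hm₁⟩ := D.exists_nearPoint_notMem_range i (α := 1) (by simp) hη1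
  obtain ⟨ε₂, hε₂, hm₂⟩ := D.exists_nearPoint_notMem_range i (α := -1) (by simp) hη1
  have hab := D.firstTime_le_lastTime j
  set a := D.firstTime j with ha
  set b := D.lastTime j with hb
  set t₀ := D.underTime i with ht₀
  -- `δ` is so small that the half-strand up to time `δ` is inside the span or avoids it.
  obtain ⟨δ, hδ, hδδ, hin, hout⟩ : ∃ δ, 0 < δ ∧ δ ≤ δ₀ ∧
      (D.HalfUnderInSpan i j η → t₀ ∈ Icc a b ∧ t₀ + η * δ ∈ Icc a b) ∧
      (¬ D.HalfUnderInSpan i j η → ∀ t ∈ Icc a b, η * (t - t₀) ≤ 0 ∨ δ ≤ η * (t - t₀)) := by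
    by_cases h : D.HalfUnderInSpan i j η
    · rcases h with ⟨rfl, h1, h2⟩ | ⟨rfl, h1, h2⟩
      · refine ⟨min δ₀ (b - t₀), lt_min hδ₀ (by linarith), min_le_left _ _,
          fun _ => ⟨⟨h1, h2.le⟩, ?_, ?_⟩, fun h => absurd (Or.inl ⟨rfl, h1, h2⟩) h⟩
        · have : 0 < min δ₀ (b - t₀) := lt_min hδ₀ (by linarith)
          linarith
        · linarith [min_le_right δ₀ (b - t₀)]
      · refine ⟨min δ₀ (t₀ - a), lt_min hδ₀ (by linarith), min_le_left _ _,
          fun _ => ⟨⟨h1.le, h2⟩, ?_, ?_⟩, fun h => absurd (Or.inr ⟨rfl, h1, h2⟩) h⟩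
        · linarith [min_le_right δ₀ (t₀ - a)]
        · have : 0 < min δ₀ (t₀ - a) := lt_min hδ₀ (by linarith)
          linarith
    · have key : ∃ δ, 0 < δ ∧ ∀ t ∈ Icc a b, η * (t - t₀) ≤ 0 ∨ δ ≤ η * (t - t₀) := by
        rcases hη with rfl | rfl
        · rcases lt_or_ge t₀ a with h1 | h1
          · exact ⟨a - t₀, by linarith, fun t ht => Or.inr (by linarith [ht.1])⟩
          · have h2 : b ≤ t₀ := by
              by_contra! h2
              exact h (Or.inl ⟨rfl, h1, h2⟩)
            exact ⟨1, one_pos, fun t ht => Or.inl (by linarith [ht.2])⟩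
        · rcases lt_or_ge b t₀ with h1 | h1
          · exact ⟨t₀ - b, by linarith, fun t ht => Or.inr (by linarith [ht.2])⟩
          · have h2 : t₀ ≤ a := by
              by_contra! h2
              exact h (Or.inr ⟨rfl, h2, h1⟩)
            exact ⟨1, one_pos, fun t ht => Or.inl (by linarith [ht.1])⟩
      obtain ⟨δ, hδ, hk⟩ := key
      exact ⟨min δ δ₀, lt_min hδ hδ₀, min_le_right _ _, fun h' => absurd h' h,
        fun _ t ht => (hk t ht).imp_right (min_le_left _ _).trans⟩
  filter_upwards [H δ hδ hδδ η hη, Ioo_mem_nhdsGT hε₁, Ioo_mem_nhdsGT hε₂] with ε h hmε₁ hmε₂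
  obtain ⟨hneg, hpos, hstart, hend⟩ := h _ rfl
  have w₁ := D.spanWinding_spec j (hm₁ ε hmε₁)
  have w₂ := D.spanWinding_spec j (hm₂ ε hmε₂)
  have hcl := D.curve_firstTime_eq j
  have hcont : ContinuousOn D.curve (Icc a b) := D.continuous_curve.continuousOn
  by_cases hS : D.HalfUnderInSpan i j η
  · rw [if_pos hS]
    obtain ⟨hi₁, hi₂⟩ := hin hS
    -- The times at which the half-strand starts and ends, in increasing order.
    obtain ⟨p, q, hap, hpq, hqb, hpq', hrest, hp, hq⟩ : ∃ p q, a ≤ p ∧ p ≤ q ∧ q ≤ b ∧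
        (∀ t ∈ Icc p q, 0 ≤ η * (t - t₀) ∧ η * (t - t₀) ≤ δ) ∧
        (∀ t ∈ Icc a p ∪ Icc q b, η * (t - t₀) ≤ 0 ∨ δ ≤ η * (t - t₀)) ∧
        ((D.curve p - D.nearPoint i 1 η ε) * conj (D.curve p - D.nearPoint i (-1) η ε)).im
          * D.dirDet i < 0 ∧
        0 < ((D.curve q - D.nearPoint i 1 η ε) * conj (D.curve q - D.nearPoint i (-1) η ε)).im
          * D.dirDet i := by
      rcases hη with rfl | rfl
      · refine ⟨t₀, t₀ + 1 * δ, hi₁.1, by linarith, hi₂.2, fun t ht => ?_, fun t ht => ?_,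
          by linarith, by linarith⟩
        · constructor <;> linarith [ht.1, ht.2]
        · rcases ht with ht | ht
          · left; linarith [ht.2]
          · right; linarith [ht.1]
      · refine ⟨t₀ + -1 * δ, t₀, hi₂.1, by linarith, hi₁.2, fun t ht => ?_, fun t ht => ?_,
          by linarith, by linarith⟩
        · constructor <;> linarith [ht.1, ht.2]
        · rcases ht with ht | ht
          · right; linarith [ht.2]
          · left; linarith [ht.1]
    rcases lt_or_gt_of_ne (D.dirDet_ne_zero i) with hκ | hκ
    -- For a negative crossing, the two ends of the segment exchange their roles.
    · have hσ : D.σ i = -1 := if_neg (not_lt.2 hκ.le)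
      have hconj : ∀ t, (D.curve t - D.nearPoint i (-1) η ε) *
          conj (D.curve t - D.nearPoint i 1 η ε) = conj ((D.curve t - D.nearPoint i 1 η ε) *
          conj (D.curve t - D.nearPoint i (-1) η ε)) := by
        intro t; rw [map_mul, conj_conj, mul_comm]
      have := w₂.sub_eq_one_of_crossing w₁ hcont hcl hap hpq hqb
        (fun t ht => by
          rw [hconj, mem_slitPlane_iff, conj_re, conj_im, neg_ne_zero, ← mem_slitPlane_iff]
          exact hpos t (hrest t ht))
        (fun t ht => by
          rw [hconj, ← map_neg, mem_slitPlane_iff, conj_re, conj_im, neg_ne_zero,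
            ← mem_slitPlane_iff]
          exact hneg t (hpq' t ht).1 (hpq' t ht).2)
        (by rw [hconj, conj_im]; nlinarith) (by rw [hconj, conj_im]; nlinarith)
      rw [hσ]; omega
    · have hσ : D.σ i = 1 := if_pos hκ
      have := w₁.sub_eq_one_of_crossing w₂ hcont hcl hap hpq hqb
        (fun t ht => hpos t (hrest t ht))
        (fun t ht => hneg t (hpq' t ht).1 (hpq' t ht).2)
        (by nlinarith) (by nlinarith)
      rw [hσ, this]
  · rw [if_neg hS, w₁.eq_of_forall_mem_slitPlane w₂ hab hcont hcl
      (fun t ht => hpos t (hout hS t ht)), sub_self]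

/-! ### Corners -/

/-- Each corner `(a, s)` at crossing `i` contributes to the `(i, j)` entry of `A(K) W(K)` the winding
number of the span `Sp(j)` around a point of the corner, times the marking. If the region of the
corner is unbounded, no column of `A(K)` contains the marking, but then the winding number is `0`. -/
theorem eventually_sum_cornerMark (ρ : Fin n ≃ D.BoundedRegion) (i j : Fin n) {a s : ℤ}
    (ha : |(a : ℝ)| = 1) (hs : |(s : ℝ)| = 1) (m : ℤ[T;T⁻¹]) :
    ∀ᶠ ε in 𝓝[>] (0 : ℝ),
      ∑ l, D.cornerMark i a s (ρ l).1 m * D.windingMatrix ρ l j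
        = m * (D.spanWinding j (D.nearPoint i a (s * D.σ i) ε) : ℤ[T;T⁻¹]) := by
  classical
  have hσ : |((s : ℝ) * D.σ i)| = 1 := by
    rw [abs_mul, hs]; unfold σ; split_ifs <;> simp
  obtain ⟨ε₀, hε₀, hm⟩ := D.exists_nearPoint_notMem_range i ha hσ
  have hray : IsPreconnected (D.nearPoint i a (s * D.σ i) '' Ioo 0 ε₀) :=
    isPreconnected_Ioo.image _ (by unfold nearPoint; fun_prop)
  have hev : ∀ᶠ ε in 𝓝[>] (0 : ℝ), ε ∈ Ioo 0 ε₀ := Ioo_mem_nhdsGT hε₀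
  filter_upwards [hev] with ε hε
  set z := D.nearPoint i a (s * D.σ i) ε with hz
  set C := connectedComponentIn (range D.curve)ᶜ z with hC
  have hzm : z ∈ (range D.curve)ᶜ := hm ε hε
  have hsub : D.nearPoint i a (s * D.σ i) '' Ioo 0 ε₀ ⊆ C :=
    hray.subset_connectedComponentIn (mem_image_of_mem _ hε)
      (by rintro _ ⟨e, he, rfl⟩; exact hm e he)
  have hcorner : ∀ l, D.CornerIn i a s (ρ l).1 ↔ (ρ l).1 = C := by
    intro l
    have hp : ∀ e : ℝ, D.crossing i + e * (a * D.overDir i + s * D.σ i * D.underDir i)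
        = D.nearPoint i a (s * D.σ i) e := by
      intro e; simp [nearPoint]
    simp only [CornerIn, hp]
    constructor
    · intro h
      obtain ⟨e, he, heε⟩ := (h.and hev).exists
      obtain ⟨⟨y, hy, hR⟩, -⟩ := (ρ l).2
      rw [hR] at he ⊢
      rw [connectedComponentIn_eq he, hC, connectedComponentIn_eq (hsub ⟨e, heε, rfl⟩)]
    · intro h
      rw [h]
      exact hev.mono fun e he => hsub ⟨e, he, rfl⟩
  by_cases hb : Bornology.IsBounded C
  · obtain ⟨l, hl⟩ := ρ.surjective ⟨C, ⟨z, hzm, rfl⟩, hb⟩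
    have hl' : (ρ l).1 = C := by rw [hl]
    rw [Finset.sum_eq_single l]
    · rw [cornerMark, if_pos ((hcorner l).2 hl'), windingMatrix, Matrix.of_apply, hl',
        D.regionWinding_component j hzm]
    · intro l' _ hne
      rw [cornerMark, if_neg, zero_mul]
      rw [hcorner, ← hl']
      exact fun h => hne (ρ.injective (Subtype.ext h))
    · simp
  · rw [D.spanWinding_eq_zero_of_not_isBounded j hb, Int.cast_zero, mul_zero]
    refine Finset.sum_eq_zero fun l _ => ?_
    rw [cornerMark, if_neg, zero_mul]
    rw [hcorner]
    exact fun h => hb (h ▸ (ρ l).2.2)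

open Classical in
/-- The `(i, j)` entry of `A(K) W(K)` depends only on which halves of the under strand at crossing `i`
belong to the span `Sp(j)`: the two markings on the same side of the over strand are opposite, and
the winding numbers of these two corners differ by the jump across the half of the under strand which
separates them. -/
theorem alexanderMatrix_mul_windingMatrix_apply (ρ : Fin n ≃ D.BoundedRegion) (i j : Fin n) :
    (D.alexanderMatrix ρ * D.windingMatrix ρ) i j
      = xpow 1 * ((if D.HalfUnderInSpan i j (-D.σ i) then D.σ i else 0 : ℤ) : ℤ[T;T⁻¹])
        - ((if D.HalfUnderInSpan i j (D.σ i) then D.σ i else 0 : ℤ) : ℤ[T;T⁻¹]) := by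
  have hσ : (D.σ i : ℝ) = 1 ∨ (D.σ i : ℝ) = -1 := by unfold σ; split_ifs <;> simp
  have hσ' : (-D.σ i : ℝ) = 1 ∨ (-D.σ i : ℝ) = -1 := by
    rcases hσ with h | h <;> simp [h]
  obtain ⟨ε, j₁, j₂, c₁, c₂, c₃, c₄⟩ := ((D.eventually_spanWinding_sub i j hσ).and
    ((D.eventually_spanWinding_sub i j hσ').and
    ((D.eventually_sum_cornerMark ρ i j (a := -1) (s := -1) (by simp) (by simp) (-xpow 1)).and
    ((D.eventually_sum_cornerMark ρ i j (a := 1) (s := -1) (by simp) (by simp) (xpow 1)).and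
    ((D.eventually_sum_cornerMark ρ i j (a := -1) (s := 1) (by simp) (by simp) 1).and
    (D.eventually_sum_cornerMark ρ i j (a := 1) (s := 1) (by simp) (by simp) (-1))))))).exists
  rw [Matrix.mul_apply]
  simp only [alexanderMatrix, Matrix.of_apply, add_mul, Finset.sum_add_distrib, c₁, c₂, c₃, c₄]
  rw [← j₁, ← j₂]
  simp only [Int.cast_neg, Int.cast_one, neg_mul, one_mul, Int.cast_sub]
  ring

theorem σ_eq (i : Fin n) : D.σ i = 1 ∨ D.σ i = -1 := by unfold σ; split_ifs <;> simp

theorem S_eq (i : Fin n) : D.S i = 1 ∨ D.S i = -1 := by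
  rcases D.σ_eq i with h | h <;> simp only [S, d, h] <;> split_ifs <;> simp

theorem alexanderMatrix_mul_windingMatrix_self (ρ : Fin n ≃ D.BoundedRegion) (j : Fin n) :
    (D.alexanderMatrix ρ * D.windingMatrix ρ) j j = (D.d j : ℤ[T;T⁻¹]) * xpow ((1 + D.S j) / 2) := by
  classical
  have h1 : ¬ ((-1 : ℝ) = 1) := by norm_num
  have h1' : ¬ ((1 : ℝ) = -1) := by norm_num
  -- `Sp(j)` starts with the outgoing half of the under strand if the ant first goes under, and ends
  -- with the incoming half otherwise.
  rw [alexanderMatrix_mul_windingMatrix_apply]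
  rcases lt_or_gt_of_ne (D.over_ne_under j) with h | h <;>
    rcases D.σ_eq j with hσ | hσ <;>
    simp [HalfUnderInSpan, firstTime, lastTime, hσ, S, d, h, h.le, h.not_gt, h1, h1', xpow]

theorem alexanderMatrix_mul_windingMatrix_of_ne (ρ : Fin n ≃ D.BoundedRegion) {i j : Fin n}
    (hij : i ≠ j) :
    (D.alexanderMatrix ρ * D.windingMatrix ρ) i j
      = (D.σ i : ℤ[T;T⁻¹]) * (xpow 1 - 1) * D.TMatrix j i := by
  classical
  have hc : ∀ t, D.curve t = D.crossing j → D.underTime i ≠ t := by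
    rintro _ ht rfl
    rw [← D.curve_over_eq_under] at ht
    exact hij (D.crossing_injective ht)
  have ho := hc (D.overTime j) rfl
  have hu := hc (D.underTime j) (D.curve_over_eq_under j).symm
  have hf : D.underTime i ≠ D.firstTime j := by
    unfold firstTime; rcases min_choice (D.overTime j) (D.underTime j) with h | h <;> rwa [h]
  have hl : D.underTime i ≠ D.lastTime j := by
    unfold lastTime; rcases max_choice (D.overTime j) (D.underTime j) with h | h <;> rwa [h]
  -- No end point of `Sp(j)` is a passage through crossing `i`, so both halves of its under strand are
  -- in the span or neither is.
  have hH : ∀ η : ℝ, η = 1 ∨ η = -1 →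
      (D.HalfUnderInSpan i j η ↔ D.underTime i ∈ D.spanTimes j) := by
    have h1 : ¬ ((-1 : ℝ) = 1) := by norm_num
    have h1' : ¬ ((1 : ℝ) = -1) := by norm_num
    rintro η (rfl | rfl)
    · simp [HalfUnderInSpan, spanTimes, h1', hf.symm.le_iff_lt]
    · simp [HalfUnderInSpan, spanTimes, h1, hl.le_iff_lt]
  rw [alexanderMatrix_mul_windingMatrix_apply]
  rcases D.σ_eq i with hσ | hσ <;> by_cases hT : D.underTime i ∈ D.spanTimes j <;>
    (simp [hσ, hH, hT, TMatrix, xpow]; try ring)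

end LongKnotDiagram

end

/-! ### The product of the Alexander matrix and the winding matrix -/

theorem mainTheorem2 {n : ℕ} (D : LongKnotDiagram n) (ρ : Fin n ≃ D.BoundedRegion) :
    D.sigmaMatrix * D.alexanderMatrix ρ * D.windingMatrix ρ * D.SMatrix * D.XNegHalf
        = 1 + D.TMatrix.transpose * (1 - D.XNegS) ∧
    (∀ j, (D.alexanderMatrix ρ * D.windingMatrix ρ) j j
        = (D.d j : LaurentPolynomial ℤ) * LongKnotDiagram.xpow ((1 + D.S j) / 2)) ∧
    (∀ i j, i ≠ j → (D.alexanderMatrix ρ * D.windingMatrix ρ) i j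
        = (D.σ i : LaurentPolynomial ℤ) * (LongKnotDiagram.xpow 1 - 1) * D.TMatrix j i) := by
  refine ⟨?_, D.alexanderMatrix_mul_windingMatrix_self ρ,
    fun i j => D.alexanderMatrix_mul_windingMatrix_of_ne ρ⟩
  have hX : D.XNegS = Matrix.diagonal fun i => LongKnotDiagram.xpow (-D.S i) := rfl
  have hxx : ∀ k, LongKnotDiagram.xpow k * LongKnotDiagram.xpow (-k) = 1 := fun k => by
    rw [LongKnotDiagram.xpow, LongKnotDiagram.xpow, ← LaurentPolynomial.T_add, add_neg_cancel,
      LaurentPolynomial.T_zero]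
  have hσσ : ∀ i, (D.σ i : LaurentPolynomial ℤ) * D.σ i = 1 := fun i => by
    rcases D.σ_eq i with h | h <;> simp [h]
  ext1 i j
  rw [Matrix.mul_assoc D.sigmaMatrix, LongKnotDiagram.XNegHalf, LongKnotDiagram.SMatrix,
    LongKnotDiagram.sigmaMatrix, hX, ← Matrix.diagonal_one, Matrix.diagonal_sub,
    Matrix.mul_diagonal, Matrix.mul_diagonal, Matrix.diagonal_mul, Matrix.add_apply,
    Matrix.mul_diagonal, Matrix.transpose_apply]
  rcases eq_or_ne i j with rfl | hij
  · -- The passages through crossing `i` are the end points of `Sp(i)`, which is open.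
    have hT : D.TMatrix i i = 0 := by
      have : D.underTime i ∉ D.spanTimes i := by
        simpa [LongKnotDiagram.spanTimes, LongKnotDiagram.firstTime, LongKnotDiagram.lastTime]
          using le_of_lt
      simp [LongKnotDiagram.TMatrix, this]
    have hσdS : (D.σ i : LaurentPolynomial ℤ) * D.d i * D.S i = 1 := by
      rw [← Int.cast_mul, ← Int.cast_mul]
      rcases D.S_eq i with h | h <;> rw [← LongKnotDiagram.S, h] <;> simp
    rw [hT, D.alexanderMatrix_mul_windingMatrix_self, Matrix.diagonal_apply_eq]
    linear_combination (D.σ i : LaurentPolynomial ℤ) * D.d i * D.S i * hxx ((1 + D.S i) / 2) + hσdS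
  · rw [D.alexanderMatrix_mul_windingMatrix_of_ne ρ hij, Matrix.diagonal_apply_ne _ hij]
    have h0 : LongKnotDiagram.xpow 0 = 1 := LaurentPolynomial.T_zero
    rcases D.S_eq j with hS | hS
    · simp only [hS, Int.cast_one, Int.reduceAdd, Int.reduceDiv]
      linear_combination D.TMatrix j i * hxx 1
        + (LongKnotDiagram.xpow 1 - 1) * LongKnotDiagram.xpow (-1) * D.TMatrix j i * hσσ i
    · simp only [hS, Int.cast_neg, Int.cast_one, Int.reduceNeg, Int.reduceAdd,
        Int.zero_ediv, neg_zero, neg_neg, h0]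
      linear_combination (1 - LongKnotDiagram.xpow 1) * D.TMatrix j i * hσσ i
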